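/- Let $S$ be a nonempty set with an algebra $\Sigma$ of subsets, let $X$ be a nonempty convex subset of a real vector space, and let $\mathcal F$ be the set of $\Sigma$-measurable functions $f:S\to X$ with finite range (acts), with statewise mixtures; each $x\in X$ is identified with the constant act $x$. Let $\triangle(S)$ be the set of finitely additive probability measures on $\Sigma$, with the weak* topology. Let $\succsim$ be a binary relation on $\mathcal F$, with asymmetric part $\succ$ and symmetric part $\sim$. The following are equivalent. (i) $\succsim$ is MBA, that is: (weak order) it is complete and transitive; (risk independence) for all $x,y,z\in X$ and $\alpha\in(0,1)$, $x\sim y$ implies $\alpha x+(1-\alpha)z\sim\alpha y+(1-\alpha)z$, and $x\succ y$ implies $\alpha x+(1-\alpha)z\succ\alpha y+(1-\alpha)z$; (Archimedean continuity) if $f\succ g\succ h$, there are $\alpha,\beta\in(0,1)$ with $\alpha f+(1-\alpha)h\succ g\succ\beta f+(1-\beta)h$; (monotonicity) if $f(s)\succsim g(s)$ for all $s\in S$, then $f\succsim g$. Moreover there is a worst consequence, i.e. some $x_*\in X$ with $y\succsim x_*$ for all $y\in X$, and $\succsim$ exhibits decreasing relative ambiguity aversion: for all $f\in\mathcal F$,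 $y\in X$, worst consequences $x_*$ and $\alpha\le\beta$ in $(0,1)$, if $\alpha f+(1-\alpha)x_*\succsim\alpha y+(1-\alpha)x_*$, then $\beta f+(1-\beta)x_*\succsim\beta y+(1-\beta)x_*$. (ii) There exist an affine $u:X\to\mathbb R$ with $\min u(X)=0$ and, for every $f\in\mathcal F$, a set $D_f$ of upper semicontinuous and quasiconcave functions $d:\triangle(S)\to[0,\infty]$ such that, writing $$V(f)=\max_{d\in D_f}\ \min_{p\in\triangle(S)}\frac{\int_S u(f)\,\mathrm dp}{d(p)}$$ (with $a/0=\infty$ for every $a\ge 0$, including $a=0$, and $a/\infty=0$), all these minima and the maxima are attained, $V$ is finite, and: $f\succsim g\iff V(f)\ge V(g)$ for all $f,g\in\mathcal F$; $V(x)=u(x)$ for all $x\in X$; $D_f\subseteq D_g$ whenever $u(f)\le u(g)$ pointwise; and $V(f)$ depends continuously on $u(f)$ with respect to the supremum norm, i.e. for every $f\in\mathcal F$ and $\varepsilon>0$ there is $\delta>0$ such that $|V(g)-V(f)|<\varepsilon$ for all $g\in\mathcal F$ with $|u(g(s))-u(f(s))|<\delta$ for every $s\in S$. -/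

import Mathlib

open scoped NNReal ENNReal

/-- A simple function on the states `S`, measurable for the algebra of events `𝒜` (a Boolean
subalgebra of the power set of `S`), with values in `C`.  For `C` the set of consequences these are
the acts; for `C = ℝ` these are the real-valued simple functions. -/
structure SimpleAct {S : Type*} (𝒜 : BooleanSubalgebra (Set S)) (C : Type*) where
  toFun : S → C
  finite_range : (Set.range toFun).Finite
  measurable : ∀ c : C, toFun ⁻¹' {c} ∈ 𝒜

namespace SimpleAct

variable {S : Type*} {𝒜 : BooleanSubalgebra (Set S)} {C C' : Type*}

instance : CoeFun (SimpleAct 𝒜 C) (fun _ => S → C) := ⟨SimpleAct.toFun⟩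

theorem biUnion_mem {ι : Type*} {T : Set ι} (hT : T.Finite) (A : ι → Set S)
    (hA : ∀ i ∈ T, A i ∈ 𝒜) : (⋃ i ∈ T, A i) ∈ 𝒜 := by
  induction T, hT using Set.Finite.induction_on with
  | empty => simpa using 𝒜.bot_mem'
  | @insert i T _ _ ih =>
    rw [Set.biUnion_insert]
    exact 𝒜.supClosed (hA i (Set.mem_insert _ _))
      (ih fun j hj => hA j (Set.mem_insert_of_mem _ hj))

/-- The preimage of every set of values under a simple act is an event. -/
theorem preimage_mem (f : SimpleAct 𝒜 C) (T : Set C) : f ⁻¹' T ∈ 𝒜 := by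
  have h : f ⁻¹' T = ⋃ c ∈ Set.range f ∩ T, f ⁻¹' {c} := by
    ext s
    simp
  rw [h]
  exact biUnion_mem (f.finite_range.inter_of_left T) _ fun c _ => f.measurable c

/-- The constant act. -/
def const (𝒜 : BooleanSubalgebra (Set S)) (c : C) : SimpleAct 𝒜 C where
  toFun := fun _ => c
  finite_range := Set.finite_range_const
  measurable := fun c' => by
    by_cases h : c = c'
    · have : (fun _ : S => c) ⁻¹' {c'} = ⊤ := by ext; simp [h]
      rw [this]; exact BooleanSubalgebra.top_mem
    · have : (fun _ : S => c) ⁻¹' {c'} = ⊥ := by ext; simp [h]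
      rw [this]; exact 𝒜.bot_mem'

/-- Statewise application of a map of values: `map u f` is the simple function `u ∘ f`. -/
def map (u : C → C') (f : SimpleAct 𝒜 C) : SimpleAct 𝒜 C' where
  toFun := fun s => u (f s)
  finite_range := by
    have : Set.range (fun s => u (f s)) = u '' Set.range f := Set.range_comp u f
    rw [this]; exact f.finite_range.image u
  measurable := fun c => f.preimage_mem (u ⁻¹' {c})

/-- Statewise application of a binary operation on values. -/
def map₂ (m : C → C → C') (f g : SimpleAct 𝒜 C) : SimpleAct 𝒜 C' where
  toFun := fun s => m (f s) (g s)
  finite_range := by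
    refine (Set.Finite.image2 m f.finite_range g.finite_range).subset ?_
    rintro _ ⟨s, rfl⟩
    exact ⟨f s, ⟨s, rfl⟩, g s, ⟨s, rfl⟩, rfl⟩
  measurable := fun c => by
    have h : (fun s => m (f s) (g s)) ⁻¹' {c} =
        ⋃ x ∈ Set.range f, f ⁻¹' {x} ∩ g ⁻¹' {y | m x y = c} := by
      ext s
      simp only [Set.mem_preimage, Set.mem_singleton_iff, Set.mem_iUnion, Set.mem_inter_iff,
        Set.mem_ofPred_eq, exists_prop]
      constructor
      · intro hs
        exact ⟨f s, ⟨s, rfl⟩, rfl, hs⟩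
      · rintro ⟨x, _, hx, hs⟩
        rw [hx]
        exact hs
    rw [h]
    exact biUnion_mem f.finite_range _ fun x _ =>
      𝒜.infClosed (f.measurable x) (g.preimage_mem _)

end SimpleAct

/-- The finitely additive probability measures on the algebra `𝒜`, as a subset of `𝒜 → ℝ`.
As a subtype it carries the topology of setwise convergence on events, which is the weak*
topology. -/
def finAddProb {S : Type*} (𝒜 : BooleanSubalgebra (Set S)) : Set (𝒜 → ℝ) :=
  {p | (∀ A, 0 ≤ p A) ∧ p ⊤ = 1 ∧ ∀ A B, Disjoint A B → p (A ⊔ B) = p A + p B}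

section

variable {S : Type*} {𝒜 : BooleanSubalgebra (Set S)}

/-- The integral `∫ φ dp` of a real-valued simple function. -/
noncomputable def simpleIntegral (φ : SimpleAct 𝒜 ℝ) (p : finAddProb 𝒜) : ℝ :=
  ∑ t ∈ φ.finite_range.toFinset, t * p.1 ⟨φ ⁻¹' {t}, φ.measurable t⟩

/-- Quasiconcavity of a `[0, ∞]`-valued function on the finitely additive probabilities. -/
def IsQuasiconcave (d : finAddProb 𝒜 → ℝ≥0∞) : Prop :=
  ∀ (p q r : finAddProb 𝒜) (a b : ℝ), 0 ≤ a → 0 ≤ b → a + b = 1 →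
    r.1 = a • p.1 + b • q.1 → min (d p) (d q) ≤ d r

open Classical in
/-- The ratio `∫ φ dp / d(p)` in `[0, ∞]`, for `φ ≥ 0`.  Division by `0` gives `∞`, also when the
numerator is `0`, so the models with `d(p) = 0` never matter; division by `∞` gives `0`. -/
noncomputable def confRatio (φ : SimpleAct 𝒜 ℝ) (d : finAddProb 𝒜 → ℝ≥0∞)
    (p : finAddProb 𝒜) : ℝ≥0∞ :=
  if d p = 0 then ⊤ else ENNReal.ofReal (simpleIntegral φ p) / d p

/-- `v = max_{d ∈ D} min_p ∫ φ dp / d(p)`, including that all these minima and the maximum are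
attained. -/
def IsMaxMinConf (φ : SimpleAct 𝒜 ℝ) (D : Set (finAddProb 𝒜 → ℝ≥0∞)) (v : ℝ≥0∞) : Prop :=
  (∀ d ∈ D, ∃ m, IsLeast (Set.range (confRatio φ d)) m) ∧
    IsGreatest {m | ∃ d ∈ D, IsLeast (Set.range (confRatio φ d)) m} v

end

section

variable {S : Type*} {𝒜 : BooleanSubalgebra (Set S)}
  {E : Type*} [AddCommGroup E] [Module ℝ E] {X : Set E}

/-- The mixture `a x + (1 - a) y` of two consequences. -/
def mixPt (hX : Convex ℝ X) (a : unitInterval) (x y : X) : X :=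
  ⟨(a : ℝ) • (x : E) + (1 - (a : ℝ)) • (y : E),
    hX x.2 y.2 a.2.1 (sub_nonneg.2 a.2.2) (by ring)⟩

/-- The statewise mixture `a f + (1 - a) g` of two acts. -/
def mixAct (hX : Convex ℝ X) (a : unitInterval) (f g : SimpleAct 𝒜 X) : SimpleAct 𝒜 X :=
  SimpleAct.map₂ (mixPt hX a) f g

/-- The asymmetric part of a relation. -/
def StrictPref {F : Type*} (R : F → F → Prop) (f g : F) : Prop := R f g ∧ ¬ R g f

/-- The symmetric part of a relation. -/
def Indiff {F : Type*} (R : F → F → Prop) (f g : F) : Prop := R f g ∧ R g f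

/-- Monotone, Bernoulli, Archimedean preferences over acts. -/
structure IsMBA (hX : Convex ℝ X) (R : SimpleAct 𝒜 X → SimpleAct 𝒜 X → Prop) : Prop where
  complete : ∀ f g, R f g ∨ R g f
  transitive : ∀ f g h, R f g → R g h → R f h
  risk_independence_indiff : ∀ (x y z : X) (a : unitInterval), 0 < a → a < 1 →
    Indiff R (SimpleAct.const 𝒜 x) (SimpleAct.const 𝒜 y) →
    Indiff R (SimpleAct.const 𝒜 (mixPt hX a x z)) (SimpleAct.const 𝒜 (mixPt hX a y z))
  risk_independence_strict : ∀ (x y z : X) (a : unitInterval), 0 < a → a < 1 →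
    StrictPref R (SimpleAct.const 𝒜 x) (SimpleAct.const 𝒜 y) →
    StrictPref R (SimpleAct.const 𝒜 (mixPt hX a x z)) (SimpleAct.const 𝒜 (mixPt hX a y z))
  archimedean : ∀ f g h, StrictPref R f g → StrictPref R g h →
    ∃ a b : unitInterval, 0 < a ∧ a < 1 ∧ 0 < b ∧ b < 1 ∧
      StrictPref R (mixAct hX a f h) g ∧ StrictPref R g (mixAct hX b f h)
  monotone : ∀ f g : SimpleAct 𝒜 X,
    (∀ s, R (SimpleAct.const 𝒜 (f s)) (SimpleAct.const 𝒜 (g s))) → R f g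

/-- `x` is a worst consequence. -/
def IsWorst (R : SimpleAct 𝒜 X → SimpleAct 𝒜 X → Prop) (x : X) : Prop :=
  ∀ y : X, R (SimpleAct.const 𝒜 y) (SimpleAct.const 𝒜 x)

/-- Decreasing relative ambiguity aversion, for mixtures with every worst consequence. -/
def IsDRAA (hX : Convex ℝ X) (R : SimpleAct 𝒜 X → SimpleAct 𝒜 X → Prop) : Prop :=
  ∀ w : X, IsWorst R w → ∀ (f : SimpleAct 𝒜 X) (y : X) (a b : unitInterval),
    0 < a → a ≤ b → b < 1 →
    R (mixAct hX a f (SimpleAct.const 𝒜 w)) (SimpleAct.const 𝒜 (mixPt hX a y w)) →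
    R (mixAct hX b f (SimpleAct.const 𝒜 w)) (SimpleAct.const 𝒜 (mixPt hX b y w))

/-- Affine functions on the convex set of consequences. -/
def IsAffineUtility (hX : Convex ℝ X) (u : X → ℝ) : Prop :=
  ∀ (a : unitInterval) (x y : X), u (mixPt hX a x y) = a * u x + (1 - a) * u y

/-- The act-dependent confidence representation of `R` by a utility `u` and sets `D f` of
confidence functions; `V f` is the value `max_{d ∈ D f} min_p ∫ u(f) dp / d(p)`. -/
structure IsConfidenceRep (hX : Convex ℝ X) (R : SimpleAct 𝒜 X → SimpleAct 𝒜 X → Prop)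
    (u : X → ℝ) (D : SimpleAct 𝒜 X → Set (finAddProb 𝒜 → ℝ≥0∞))
    (V : SimpleAct 𝒜 X → ℝ≥0) : Prop where
  affine : IsAffineUtility hX u
  min_eq_zero : IsLeast (Set.range u) 0
  usc : ∀ f, ∀ d ∈ D f, UpperSemicontinuous d
  quasiconcave : ∀ f, ∀ d ∈ D f, IsQuasiconcave d
  value : ∀ f, IsMaxMinConf (SimpleAct.map u f) (D f) (V f)
  represents : ∀ f g, R f g ↔ V g ≤ V f
  normalized : ∀ x : X, (V (SimpleAct.const 𝒜 x) : ℝ) = u x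
  increasing : ∀ f g : SimpleAct 𝒜 X, (∀ s, u (f s) ≤ u (g s)) → D f ⊆ D g
  /-- The value depends continuously on the utility profile `u(f)`, for the supremum norm. -/
  continuous : ∀ f : SimpleAct 𝒜 X, ∀ ε > 0, ∃ δ > 0, ∀ g : SimpleAct 𝒜 X,
    (∀ s, |u (g s) - u (f s)| < δ) → |(V g : ℝ) - V f| < ε

end

/-! ### Integrals of simple functions and the confidence functions `∫ ψ dp / v` -/

section Integral

variable {S : Type*} {𝒜 : BooleanSubalgebra (Set S)} {C : Type*}

/-! Normalise `u` to vanish at the worst consequence `w`. Mixing an act with `w` then scales its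
utility profile down, and decreasing relative ambiguity aversion becomes V(a f + (1-a) w) ≤ a V(f)
(`value_mixAct_worst_le`). With monotonicity this gives: if t ≥ 1 and t u(g) ≤ u(f), then t V(g) ≤
V(f). Both directions turn on this inequality.

From the axioms, `exists_affine_utility` supplies `u`, and certainty equivalents extend it to `V`
(`exists_utilityExtension`). Let D_f consist of the functions p ↦ ∫ u(g) dp / V(g) with u(g) ≤ u(f),
read as ∞ when V(g) = 0. They are continuous, and affine in p or constantly ∞, and D_f grows with
u(f). When V(g) > 0 the minimal ratio is t V(g), where t is the largest number with t u(g) ≤ u(f)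
(`exists_isLeast_confRatio_confFun`). Since u(g) ≤ u(f), t ≥ 1, so this is at most V(f), and g = f
attains it (`isMaxMinConf_value`). Continuity of `V` comes from the Archimedean axiom
(`continuous_value`).

Conversely, a larger set D and a profile scaled up by t raise the max-min value at least by the
factor t (`IsMaxMinConf.mul_le`). Taking t = 1 gives monotonicity and t = b / a gives decreasing
aversion; continuity gives back the Archimedean axiom. -/

theorem finAddProb_bot (p : finAddProb 𝒜) : p.1 ⊥ = 0 := by
  have h := p.2.2.2 ⊥ ⊥ disjoint_bot_left
  rw [bot_sup_eq] at h
  linarith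

theorem finAddProb_preimage_finset (p : finAddProb 𝒜) (h : SimpleAct 𝒜 C) (T : Finset C) :
    p.1 ⟨h ⁻¹' (T : Set C), h.preimage_mem _⟩ = ∑ c ∈ T, p.1 ⟨h ⁻¹' {c}, h.measurable c⟩ := by
  classical
  induction T using Finset.induction_on with
  | empty =>
    rw [Finset.sum_empty, ← finAddProb_bot p]
    refine congrArg p.1 (Subtype.ext ?_)
    ext s
    simp
  | insert c T hc ih =>
    rw [Finset.sum_insert hc, ← ih, ← p.2.2.2]
    · refine congrArg p.1 (Subtype.ext ?_)
      ext s
      simp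
    · rw [disjoint_iff]
      ext s
      simp only [BooleanSubalgebra.val_inf, BooleanSubalgebra.val_bot]
      simp only [Set.inf_eq_inter, Set.mem_inter_iff, Set.mem_preimage, Set.mem_singleton_iff,
        Finset.mem_coe, Set.bot_eq_empty, Set.mem_empty_iff_false, iff_false, not_and]
      rintro rfl
      exact hc

/-- The fibres of `h` refine those of its image under `k`, so finite additivity regroups the sum.
This allows two integrands to be compared on one partition. -/
theorem simpleIntegral_map (k : C → ℝ) (h : SimpleAct 𝒜 C) (p : finAddProb 𝒜) :
    simpleIntegral (SimpleAct.map k h) p =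
      ∑ c ∈ h.finite_range.toFinset, k c * p.1 ⟨h ⁻¹' {c}, h.measurable c⟩ := by
  classical
  rw [simpleIntegral, ← Finset.sum_fiberwise_of_maps_to
    (t := (SimpleAct.map k h).finite_range.toFinset) (g := k)]
  · refine Finset.sum_congr rfl fun t _ => ?_
    have e : p.1 ⟨SimpleAct.map k h ⁻¹' {t}, (SimpleAct.map k h).measurable t⟩ =
        p.1 ⟨h ⁻¹' ((h.finite_range.toFinset.filter (k · = t) : Finset C) : Set C),
          h.preimage_mem _⟩ := by
      refine congrArg p.1 (Subtype.ext ?_)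
      ext s
      simp [SimpleAct.map]
    rw [e, finAddProb_preimage_finset, Finset.mul_sum]
    refine Finset.sum_congr rfl fun c hc => ?_
    rw [(Finset.mem_filter.1 hc).2]
  · intro c hc
    simp only [Set.Finite.mem_toFinset, Set.mem_range] at hc ⊢
    obtain ⟨s, rfl⟩ := hc
    exact ⟨s, rfl⟩

theorem mul_simpleIntegral_le {φ ψ : SimpleAct 𝒜 ℝ} {t : ℝ} (h : ∀ s, t * ψ s ≤ φ s)
    (p : finAddProb 𝒜) : t * simpleIntegral ψ p ≤ simpleIntegral φ p := by
  -- Both functions factor through the pair (φ, ψ), whose fibres form a common partition.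
  have h₁ : simpleIntegral φ p =
      simpleIntegral (SimpleAct.map Prod.fst (SimpleAct.map₂ Prod.mk φ ψ)) p := rfl
  have h₂ : simpleIntegral ψ p =
      simpleIntegral (SimpleAct.map Prod.snd (SimpleAct.map₂ Prod.mk φ ψ)) p := rfl
  rw [h₁, h₂, simpleIntegral_map, simpleIntegral_map, Finset.mul_sum]
  refine Finset.sum_le_sum fun c hc => ?_
  simp only [Set.Finite.mem_toFinset, Set.mem_range] at hc
  obtain ⟨s, rfl⟩ := hc
  rw [← mul_assoc]
  exact mul_le_mul_of_nonneg_right (h s) (p.2.1 _)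

theorem continuous_simpleIntegral (φ : SimpleAct 𝒜 ℝ) :
    Continuous fun p : finAddProb 𝒜 => simpleIntegral φ p := by
  unfold simpleIntegral
  refine continuous_finsetSum _ fun t _ => continuous_const.mul ?_
  exact (continuous_apply _).comp continuous_subtype_val

theorem simpleIntegral_combo (φ : SimpleAct 𝒜 ℝ) {p q r : finAddProb 𝒜} {a b : ℝ}
    (h : r.1 = a • p.1 + b • q.1) :
    simpleIntegral φ r = a * simpleIntegral φ p + b * simpleIntegral φ q := by
  simp only [simpleIntegral, h, Pi.add_apply, Pi.smul_apply, smul_eq_mul, Finset.mul_sum,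
    ← Finset.sum_add_distrib]
  exact Finset.sum_congr rfl fun _ _ => by ring

open Classical in
/-- The point mass at a state. -/
noncomputable def diracProb (𝒜 : BooleanSubalgebra (Set S)) (s : S) : finAddProb 𝒜 :=
  ⟨fun A => if s ∈ A.1 then 1 else 0, by
    refine ⟨fun A => by positivity, by simp, fun A B hAB => ?_⟩
    have h : ¬ (s ∈ A.1 ∧ s ∈ B.1) := by
      rintro ⟨hA, hB⟩
      have h0 : s ∈ (A ⊓ B).1 := ⟨hA, hB⟩
      rw [disjoint_iff.1 hAB] at h0
      exact h0
    have h' : s ∈ (A ⊔ B).1 ↔ s ∈ A.1 ∨ s ∈ B.1 := Iff.rfl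
    simp only [h']
    by_cases hA : s ∈ A.1 <;> by_cases hB : s ∈ B.1 <;> simp_all⟩

theorem simpleIntegral_dirac (φ : SimpleAct 𝒜 ℝ) (s : S) :
    simpleIntegral φ (diracProb 𝒜 s) = φ s := by
  classical
  rw [simpleIntegral, Finset.sum_eq_single (φ s)]
  · simp [diracProb]
  · intro t _ ht
    simp [diracProb, Ne.symm ht]
  · intro h
    simp at h

open Classical in
/-- The confidence function `p ↦ ∫ ψ dp / v`, read as `∞` when `v = 0`. -/
noncomputable def confFun (ψ : SimpleAct 𝒜 ℝ) (v : ℝ) (p : finAddProb 𝒜) : ℝ≥0∞ :=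
  if v = 0 then ⊤ else ENNReal.ofReal (simpleIntegral ψ p / v)

theorem upperSemicontinuous_confFun (ψ : SimpleAct 𝒜 ℝ) (v : ℝ) :
    UpperSemicontinuous (confFun ψ v) := by
  refine Continuous.upperSemicontinuous ?_
  by_cases hv : v = 0
  · have h : confFun ψ v = fun _ => ⊤ := funext fun p => if_pos hv
    rw [h]
    exact continuous_const
  · have h : confFun ψ v = fun p => ENNReal.ofReal (simpleIntegral ψ p / v) :=
      funext fun p => if_neg hv
    rw [h]
    exact ENNReal.continuous_ofReal.comp ((continuous_simpleIntegral ψ).div_const v)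

theorem isQuasiconcave_confFun (ψ : SimpleAct 𝒜 ℝ) {v : ℝ} (h0 : 0 ≤ v) :
    IsQuasiconcave (confFun ψ v) := by
  intro p q r a b ha hb hab hr
  by_cases hv : v = 0
  · simp [confFun, hv]
  simp only [confFun, hv, if_false]
  rw [← ENNReal.ofReal_min]
  refine ENNReal.ofReal_le_ofReal ?_
  rw [simpleIntegral_combo ψ hr, min_div_div_right h0]
  refine div_le_div_of_nonneg_right ?_ h0
  have h1 := min_le_left (simpleIntegral ψ p) (simpleIntegral ψ q)
  have h2 := min_le_right (simpleIntegral ψ p) (simpleIntegral ψ q)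
  calc min (simpleIntegral ψ p) (simpleIntegral ψ q)
      = a * min (simpleIntegral ψ p) (simpleIntegral ψ q)
        + b * min (simpleIntegral ψ p) (simpleIntegral ψ q) := by rw [← add_mul, hab, one_mul]
    _ ≤ _ := add_le_add (mul_le_mul_of_nonneg_left h1 ha) (mul_le_mul_of_nonneg_left h2 hb)

theorem isLeast_confRatio_confFun_zero [Nonempty S] (φ ψ : SimpleAct 𝒜 ℝ) :
    IsLeast (Set.range (confRatio φ (confFun ψ 0))) 0 := by
  refine ⟨⟨diracProb 𝒜 (Classical.arbitrary S), ?_⟩, fun _ _ => bot_le⟩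
  simp [confRatio, confFun]

/-- The minimal ratio for the confidence function `∫ ψ dp / v` is `t * v`, with `t` the largest
number such that `t ψ ≤ φ`; it is attained at a point mass. -/
theorem exists_isLeast_confRatio_confFun {φ ψ : SimpleAct 𝒜 ℝ} (hφ : ∀ s, 0 ≤ φ s)
    {v : ℝ} (hv : 0 < v) (hpos : ∃ s, 0 < ψ s) (hψ : ∀ s, 0 ≤ ψ s) :
    ∃ t : ℝ, 0 ≤ t ∧ (∀ s, t * ψ s ≤ φ s) ∧ (∃ s, 0 < ψ s ∧ φ s = t * ψ s) ∧
      IsLeast (Set.range (confRatio φ (confFun ψ v))) (ENNReal.ofReal (t * v)) := by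
  obtain ⟨s₁, hs₁⟩ := hpos
  have hfin : ((fun s => φ s / ψ s) '' {s | 0 < ψ s}).Finite := by
    refine (Set.Finite.image2 (fun a b : ℝ => a / b) φ.finite_range ψ.finite_range).subset ?_
    rintro _ ⟨s, _, rfl⟩
    exact ⟨φ s, ⟨s, rfl⟩, ψ s, ⟨s, rfl⟩, rfl⟩
  -- The optimal t is the least of the finitely many quotients φ / ψ where ψ > 0; the point mass at
  -- a minimising state attains it.
  obtain ⟨t, ⟨s₀, hs₀, rfl⟩, hmin⟩ := Set.exists_min_image _ id hfin ⟨_, s₁, hs₁, rfl⟩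
  simp only [Set.mem_ofPred_eq] at hs₀
  have hle : ∀ s, φ s₀ / ψ s₀ * ψ s ≤ φ s := by
    intro s
    rcases (hψ s).eq_or_lt with h | h
    · rw [← h, mul_zero]; exact hφ s
    · exact (le_div_iff₀ h).1 (hmin _ ⟨s, h, rfl⟩)
  refine ⟨φ s₀ / ψ s₀, div_nonneg (hφ _) hs₀.le, hle, ⟨s₀, hs₀, by field_simp⟩,
    ⟨diracProb 𝒜 s₀, ?_⟩, ?_⟩
  · have h : 0 < ψ s₀ / v := div_pos hs₀ hv
    simp only [confRatio, confFun, hv.ne', if_false, simpleIntegral_dirac]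
    rw [if_neg (by simpa using h), ← ENNReal.ofReal_div_of_pos h]
    congr 1
    field_simp
  · rintro _ ⟨p, rfl⟩
    simp only [confRatio, confFun, hv.ne', if_false]
    split_ifs with h
    · exact le_top
    · have h' : 0 < simpleIntegral ψ p / v := by
        simpa using h
      rw [← ENNReal.ofReal_div_of_pos h']
      refine ENNReal.ofReal_le_ofReal ?_
      rw [le_div_iff₀ h']
      have := mul_simpleIntegral_le hle p
      calc φ s₀ / ψ s₀ * v * (simpleIntegral ψ p / v)
          = φ s₀ / ψ s₀ * simpleIntegral ψ p := by field_simp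
        _ ≤ _ := this

end Integral

/-! ### Algebra of mixtures -/

section Mixtures

variable {S : Type*} {𝒜 : BooleanSubalgebra (Set S)} {C : Type*}
  {E : Type*} [AddCommGroup E] [Module ℝ E] {X : Set E} (hX : Convex ℝ X)

@[simp] theorem SimpleAct.const_apply (c : C) (s : S) : SimpleAct.const 𝒜 c s = c := rfl

@[simp] theorem mixAct_apply (a : unitInterval) (f g : SimpleAct 𝒜 X) (s : S) :
    mixAct hX a f g s = mixPt hX a (f s) (g s) := rfl

theorem mixAct_const (a : unitInterval) (x y : X) :
    mixAct hX a (SimpleAct.const 𝒜 x) (SimpleAct.const 𝒜 y) =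
      SimpleAct.const 𝒜 (mixPt hX a x y) := rfl

@[simp] theorem mixPt_zero (x y : X) : mixPt hX 0 x y = y :=
  Subtype.ext (by simp [mixPt])

@[simp] theorem mixPt_one (x y : X) : mixPt hX 1 x y = x :=
  Subtype.ext (by simp [mixPt])

@[simp] theorem mixPt_self (a : unitInterval) (x : X) : mixPt hX a x x = x :=
  Subtype.ext (by simp only [mixPt]; module)

theorem mixPt_symm (a : unitInterval) (x y : X) :
    mixPt hX (unitInterval.symm a) x y = mixPt hX a y x :=
  Subtype.ext (by simp only [mixPt, unitInterval.coe_symm_eq]; module)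

theorem mixPt_mixPt {a k l c : unitInterval} (h : (c : ℝ) = a * k + (1 - a) * l) (x y : X) :
    mixPt hX a (mixPt hX k x y) (mixPt hX l x y) = mixPt hX c x y :=
  Subtype.ext (by simp only [mixPt, h]; module)

theorem exists_unitInterval_combo (a k l : unitInterval) :
    ∃ c : unitInterval, (c : ℝ) = a * k + (1 - a) * l :=
  ⟨⟨_, (convex_Icc (0 : ℝ) 1) k.2 l.2 a.2.1 (sub_nonneg.2 a.2.2) (by ring)⟩, rfl⟩

theorem mixPt_mixPt_left (a k : unitInterval) (x y : X) :
    mixPt hX a (mixPt hX k x y) y = mixPt hX (a * k) x y :=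
  Subtype.ext (by simp only [mixPt, Set.Icc.coe_mul]; module)

end Mixtures

/-! ### Ordering mixtures of two consequences -/

namespace IsMBA

variable {S : Type*} {𝒜 : BooleanSubalgebra (Set S)}
  {E : Type*} [AddCommGroup E] [Module ℝ E] {X : Set E} {hX : Convex ℝ X}
  {R : SimpleAct 𝒜 X → SimpleAct 𝒜 X → Prop}

theorem refl (hR : IsMBA hX R) (f) : R f f := (hR.complete f f).elim id id

theorem strictPref_iff (hR : IsMBA hX R) {f g} : StrictPref R f g ↔ ¬ R g f :=
  ⟨And.right, fun h => ⟨(hR.complete f g).resolve_right h, h⟩⟩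

theorem indiff_mixPt (hR : IsMBA hX R) {x y : X} (z : X) (a : unitInterval)
    (h : Indiff R (SimpleAct.const 𝒜 x) (SimpleAct.const 𝒜 y)) :
    Indiff R (SimpleAct.const 𝒜 (mixPt hX a x z)) (SimpleAct.const 𝒜 (mixPt hX a y z)) := by
  rcases eq_or_ne a 0 with rfl | h0
  · simpa using ⟨hR.refl _, hR.refl _⟩
  rcases eq_or_ne a 1 with rfl | h1
  · simpa using h
  exact hR.risk_independence_indiff x y z a (unitInterval.pos_iff_ne_zero.2 h0)
    (unitInterval.lt_one_iff_ne_one.2 h1) h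

theorem indiff_trans (hR : IsMBA hX R) {f g h} (h₁ : Indiff R f g) (h₂ : Indiff R g h) :
    Indiff R f h :=
  ⟨hR.transitive _ _ _ h₁.1 h₂.1, hR.transitive _ _ _ h₂.2 h₁.2⟩

theorem strictPref_mixPt_left (hR : IsMBA hX R) {m w : X}
    (h : StrictPref R (SimpleAct.const 𝒜 m) (SimpleAct.const 𝒜 w)) {a : unitInterval}
    (ha : 0 < a) :
    StrictPref R (SimpleAct.const 𝒜 (mixPt hX a m w)) (SimpleAct.const 𝒜 w) := by
  rcases eq_or_ne a 1 with rfl | h1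
  · simpa using h
  simpa using hR.risk_independence_strict m w w a ha (unitInterval.lt_one_iff_ne_one.2 h1) h

theorem strictPref_mixPt_right (hR : IsMBA hX R) {m w : X}
    (h : StrictPref R (SimpleAct.const 𝒜 m) (SimpleAct.const 𝒜 w)) {a : unitInterval}
    (ha : a < 1) :
    StrictPref R (SimpleAct.const 𝒜 m) (SimpleAct.const 𝒜 (mixPt hX a m w)) := by
  rcases eq_or_ne a 0 with rfl | h0
  · simpa using h
  have hpos : 0 < unitInterval.symm a := by
    rw [unitInterval.pos_iff_ne_zero]
    intro h
    exact ha.ne (unitInterval.symm_eq_zero.1 h)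
  have hlt : unitInterval.symm a < 1 := by
    rw [unitInterval.lt_one_iff_ne_one]
    intro h
    exact h0 (unitInterval.symm_eq_one.1 h)
  have := hR.risk_independence_strict m w m _ hpos hlt h
  simpa [mixPt_symm] using this

theorem mixPt_strictMono (hR : IsMBA hX R) {m w : X}
    (h : StrictPref R (SimpleAct.const 𝒜 m) (SimpleAct.const 𝒜 w)) {a b : unitInterval}
    (hab : a < b) :
    StrictPref R (SimpleAct.const 𝒜 (mixPt hX b m w)) (SimpleAct.const 𝒜 (mixPt hX a m w)) := by
  have hb : (0 : ℝ) < b := lt_of_le_of_lt a.2.1 hab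
  have hab' : (a : ℝ) < b := hab
  -- The mixture with weight a is the mixture with weight b, diluted again by `w` with weight a / b.
  let c : unitInterval := ⟨a / b, div_nonneg a.2.1 hb.le, (div_le_one hb).2 hab'.le⟩
  have hc : c < 1 := Subtype.coe_lt_coe.1 ((div_lt_one hb).2 hab')
  have hcb : c * b = a := Subtype.ext (by simp [c, hb.ne'])
  have := hR.strictPref_mixPt_right (hR.strictPref_mixPt_left h (Subtype.coe_lt_coe.1 hb)) hc
  rwa [mixPt_mixPt_left, hcb] at this

theorem mixPt_rel_iff (hR : IsMBA hX R) {m w : X}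
    (h : StrictPref R (SimpleAct.const 𝒜 m) (SimpleAct.const 𝒜 w)) {a b : unitInterval} :
    R (SimpleAct.const 𝒜 (mixPt hX a m w)) (SimpleAct.const 𝒜 (mixPt hX b m w)) ↔ b ≤ a := by
  constructor
  · intro hr
    by_contra hlt
    exact (hR.mixPt_strictMono h (not_le.1 hlt)).2 hr
  · intro hle
    rcases hle.eq_or_lt with rfl | hlt
    · exact hR.refl _
    · exact (hR.mixPt_strictMono h hlt).1

/-- An act ranked between two consequences is indifferent to a mixture of them. -/
theorem exists_indiff (hR : IsMBA hX R) {m w : X} {f : SimpleAct 𝒜 X}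
    (hmw : StrictPref R (SimpleAct.const 𝒜 m) (SimpleAct.const 𝒜 w))
    (h₁ : R (SimpleAct.const 𝒜 m) f) (h₂ : R f (SimpleAct.const 𝒜 w)) :
    ∃ l : unitInterval, Indiff R f (SimpleAct.const 𝒜 (mixPt hX l m w)) := by
  by_cases hfm : R f (SimpleAct.const 𝒜 m)
  · exact ⟨1, by simpa using ⟨hfm, h₁⟩⟩
  by_cases hwf : R (SimpleAct.const 𝒜 w) f
  · exact ⟨0, by simpa using ⟨h₂, hwf⟩⟩
  have smf := hR.strictPref_iff.2 hfm
  have sfw := hR.strictPref_iff.2 hwf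
  -- The supremum of the weights whose mixtures are weakly below `f` is the indifferent weight: a
  -- strict preference either way contradicts it by the Archimedean axiom, which moves the weight up
  -- towards `m` in one case and down towards `w` in the other.
  let T : Set ℝ := {a | ∃ h : a ∈ unitInterval, R f (SimpleAct.const 𝒜 (mixPt hX ⟨a, h⟩ m w))}
  have hT0 : (0 : ℝ) ∈ T := ⟨unitInterval.zero_mem, by
    change R f (SimpleAct.const 𝒜 (mixPt hX 0 m w))
    simpa using h₂⟩
  have hTb : BddAbove T := ⟨1, fun a ha => ha.1.2⟩
  let l : unitInterval := ⟨sSup T, le_csSup hTb hT0, csSup_le ⟨0, hT0⟩ fun a ha => ha.1.2⟩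
  refine ⟨l, ?_⟩
  by_contra hne
  by_cases hfl : R f (SimpleAct.const 𝒜 (mixPt hX l m w))
  · have s : StrictPref R f (SimpleAct.const 𝒜 (mixPt hX l m w)) := ⟨hfl, fun h => hne ⟨hfl, h⟩⟩
    obtain ⟨-, b, -, -, hb0, -, -, hb⟩ := hR.archimedean _ _ _ smf s
    have hl1 : (l : ℝ) < 1 := by
      refine lt_of_le_of_ne l.2.2 fun h => hfm ?_
      have : l = 1 := Subtype.ext h
      simpa [this] using hfl
    obtain ⟨c, hc⟩ := exists_unitInterval_combo b 1 l
    have hb0' : (0 : ℝ) < b := hb0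
    rw [mixAct_const] at hb
    have e := mixPt_mixPt hX hc m w
    rw [mixPt_one] at e
    rw [e] at hb
    have hcT : (c : ℝ) ∈ T := ⟨c.2, hb.1⟩
    have hcl : (c : ℝ) ≤ l := le_csSup hTb hcT
    rw [hc, Set.Icc.coe_one] at hcl
    nlinarith
  · have s := hR.strictPref_iff.2 hfl
    obtain ⟨a, -, -, ha1, -, -, ha, -⟩ := hR.archimedean _ _ _ s sfw
    rw [mixAct_const, mixPt_mixPt_left] at ha
    have hl0 : (0 : ℝ) < l := by
      refine lt_of_le_of_ne l.2.1 fun h => hfl ?_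
      have : l = 0 := Subtype.ext h.symm
      simpa [this] using h₂
    have ha1' : (a : ℝ) < 1 := ha1
    have hlt : (a : ℝ) * l < sSup T := by
      change (a : ℝ) * l < (l : ℝ)
      nlinarith
    obtain ⟨c, hcT, hc⟩ := exists_lt_of_lt_csSup ⟨0, hT0⟩ hlt
    refine ha.2 (hR.transitive _ _ _ hcT.2 ?_)
    exact (hR.mixPt_rel_iff hmw).2 (Subtype.coe_le_coe.1 hc.le)

end IsMBA

/-- `x` is indifferent to the mixture of `m` and `w` that gives `m` the weight `l`. -/
def IsCalibrated {S : Type*} {𝒜 : BooleanSubalgebra (Set S)}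
    {E : Type*} [AddCommGroup E] [Module ℝ E] {X : Set E} (hX : Convex ℝ X)
    (R : SimpleAct 𝒜 X → SimpleAct 𝒜 X → Prop) (w m x : X) (l : unitInterval) : Prop :=
  Indiff R (SimpleAct.const 𝒜 x) (SimpleAct.const 𝒜 (mixPt hX l m w))

/-! ### Calibration against a reference consequence -/

namespace IsCalibrated

variable {S : Type*} {𝒜 : BooleanSubalgebra (Set S)}
  {E : Type*} [AddCommGroup E] [Module ℝ E] {X : Set E} {hX : Convex ℝ X}
  {R : SimpleAct 𝒜 X → SimpleAct 𝒜 X → Prop} {w m x y : X} {k l : unitInterval}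

theorem rel_iff (hR : IsMBA hX R)
    (h : StrictPref R (SimpleAct.const 𝒜 m) (SimpleAct.const 𝒜 w))
    (hx : IsCalibrated hX R w m x k) (hy : IsCalibrated hX R w m y l) :
    R (SimpleAct.const 𝒜 x) (SimpleAct.const 𝒜 y) ↔ l ≤ k := by
  rw [← hR.mixPt_rel_iff h]
  constructor
  · intro hr
    exact hR.transitive _ _ _ hx.2 (hR.transitive _ _ _ hr hy.1)
  · intro hr
    exact hR.transitive _ _ _ hx.1 (hR.transitive _ _ _ hr hy.2)

theorem unique (hR : IsMBA hX R)
    (h : StrictPref R (SimpleAct.const 𝒜 m) (SimpleAct.const 𝒜 w))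
    (hx : IsCalibrated hX R w m x k) (hy : IsCalibrated hX R w m x l) : k = l :=
  le_antisymm ((hy.rel_iff hR h hx).1 (hR.refl _)) ((hx.rel_iff hR h hy).1 (hR.refl _))

theorem zero (hR : IsMBA hX R) (w m : X) : IsCalibrated hX R w m w 0 := by
  simpa [IsCalibrated] using ⟨hR.refl _, hR.refl _⟩

theorem one (hR : IsMBA hX R) (w m : X) : IsCalibrated hX R w m m 1 := by
  simpa [IsCalibrated] using ⟨hR.refl _, hR.refl _⟩

theorem mix (hR : IsMBA hX R) (hx : IsCalibrated hX R w m x k) (hy : IsCalibrated hX R w m y l)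
    {a c : unitInterval} (hc : (c : ℝ) = a * k + (1 - a) * l) :
    IsCalibrated hX R w m (mixPt hX a x y) c := by
  unfold IsCalibrated
  rw [← mixPt_mixPt hX hc]
  refine hR.indiff_trans (hR.indiff_mixPt y a hx) ?_
  rw [← mixPt_symm, ← mixPt_symm hX a (mixPt hX l m w)]
  exact hR.indiff_mixPt _ _ hy

/-- Changing the reference consequence multiplies all weights by the same factor, so ratios of
weights do not depend on the reference. -/
theorem trans (hR : IsMBA hX R) {n : X} (hx : IsCalibrated hX R w m x k)
    (hm : IsCalibrated hX R w n m l) : IsCalibrated hX R w n x (k * l) := by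
  unfold IsCalibrated
  rw [← mixPt_mixPt_left]
  exact hR.indiff_trans hx (hR.indiff_mixPt w k hm)

end IsCalibrated

/-! ### Expected utility on consequences -/

namespace IsMBA

variable {S : Type*} {𝒜 : BooleanSubalgebra (Set S)}
  {E : Type*} [AddCommGroup E] [Module ℝ E] {X : Set E} {hX : Convex ℝ X}
  {R : SimpleAct 𝒜 X → SimpleAct 𝒜 X → Prop}

theorem exists_rel_both (hR : IsMBA hX R) (x y : X) :
    ∃ m, R (SimpleAct.const 𝒜 m) (SimpleAct.const 𝒜 x) ∧
      R (SimpleAct.const 𝒜 m) (SimpleAct.const 𝒜 y) ∧ (m = x ∨ m = y) := by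
  rcases hR.complete (SimpleAct.const 𝒜 x) (SimpleAct.const 𝒜 y) with h | h
  · exact ⟨x, hR.refl _, h, .inl rfl⟩
  · exact ⟨y, h, hR.refl _, .inr rfl⟩

theorem strictPref_of_rel (hR : IsMBA hX R) {f g h} (h₁ : R f g) (h₂ : StrictPref R g h) :
    StrictPref R f h :=
  hR.strictPref_iff.2 fun h' => h₂.2 (hR.transitive _ _ _ h' h₁)

/-- The expected utility theorem for consequences, with the worst consequence at `0`. -/
theorem exists_affine_utility (hR : IsMBA hX R) {w : X} (hw : IsWorst R w) :
    ∃ u : X → ℝ, IsAffineUtility hX u ∧ u w = 0 ∧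
      ∀ x y, R (SimpleAct.const 𝒜 x) (SimpleAct.const 𝒜 y) ↔ u y ≤ u x := by
  by_cases hb : ∃ b, StrictPref R (SimpleAct.const 𝒜 b) (SimpleAct.const 𝒜 w)
  swap
  · refine ⟨fun _ => 0, fun a x y => by simp, rfl, fun x y => ?_⟩
    have h : R (SimpleAct.const 𝒜 w) (SimpleAct.const 𝒜 y) := by
      by_contra h
      exact hb ⟨y, hR.strictPref_iff.2 h⟩
    simpa using hR.transitive _ _ _ (hw x) h
  obtain ⟨b, hb⟩ := hb
  have cal : ∀ {m x}, StrictPref R (SimpleAct.const 𝒜 m) (SimpleAct.const 𝒜 w) →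
      R (SimpleAct.const 𝒜 m) (SimpleAct.const 𝒜 x) → ∃ l, IsCalibrated hX R w m x l :=
    fun hm hx => hR.exists_indiff hm hx (hw _)
  -- The number r is the utility of `x` in units of `b`: the ratio of their weights, which has to be
  -- the same for every reference `m`.
  have key : ∀ x, ∃ r : ℝ, ∀ (m : X) (l k : unitInterval),
      StrictPref R (SimpleAct.const 𝒜 m) (SimpleAct.const 𝒜 w) → IsCalibrated hX R w m x l →
      IsCalibrated hX R w m b k → r * k = l := by
    intro x
    obtain ⟨n, hnx, hnb, hn⟩ := hR.exists_rel_both x b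
    have hnw := hR.strictPref_of_rel hnb hb
    obtain ⟨l₀, hl₀⟩ := cal hnw hnx
    obtain ⟨k₀, hk₀⟩ := cal hnw hnb
    have hk₀pos : (0 : ℝ) < k₀ := by
      have h : (0 : unitInterval) < k₀ := not_le.1 fun h => hb.2 ?_
      · exact h
      exact ((IsCalibrated.zero hR w n).rel_iff hR hnw hk₀).2 h
    refine ⟨l₀ / k₀, fun m l k hm hl hk => ?_⟩
    -- Any `m` that calibrates both `x` and `b` is weakly above both, hence above `n`; so `n` is
    -- calibrated by `m` and the factor `j` cancels in the ratio.
    have hmn : R (SimpleAct.const 𝒜 m) (SimpleAct.const 𝒜 n) := by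
      rcases hn with rfl | rfl
      · exact ((IsCalibrated.one hR w m).rel_iff hR hm hl).2 unitInterval.le_one'
      · exact ((IsCalibrated.one hR w m).rel_iff hR hm hk).2 unitInterval.le_one'
    obtain ⟨j, hj⟩ := cal hm hmn
    rw [hl.unique hR hm (hl₀.trans hR hj), hk.unique hR hm (hk₀.trans hR hj)]
    simp only [Set.Icc.coe_mul]
    field_simp
  choose u hu using key
  have common : ∀ x y, ∃ (m : X) (lx ly k : unitInterval),
      StrictPref R (SimpleAct.const 𝒜 m) (SimpleAct.const 𝒜 w) ∧ IsCalibrated hX R w m x lx ∧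
      IsCalibrated hX R w m y ly ∧ IsCalibrated hX R w m b k ∧ (0 : ℝ) < k := by
    intro x y
    obtain ⟨n, hnx, hny, -⟩ := hR.exists_rel_both x y
    obtain ⟨m, hmn, hmb, -⟩ := hR.exists_rel_both n b
    have hm := hR.strictPref_of_rel hmb hb
    obtain ⟨lx, hlx⟩ := cal hm (hR.transitive _ _ _ hmn hnx)
    obtain ⟨ly, hly⟩ := cal hm (hR.transitive _ _ _ hmn hny)
    obtain ⟨k, hk⟩ := cal hm hmb
    have h : (0 : unitInterval) < k := not_le.1 fun h => hb.2 ?_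
    · exact ⟨m, lx, ly, k, hm, hlx, hly, hk, h⟩
    exact ((IsCalibrated.zero hR w m).rel_iff hR hm hk).2 h
  refine ⟨u, fun a x y => ?_, ?_, fun x y => ?_⟩
  · obtain ⟨m, lx, ly, k, hm, hx, hy, hk, hpos⟩ := common x y
    obtain ⟨c, hc⟩ := exists_unitInterval_combo a lx ly
    have h₁ := hu _ m _ k hm (hx.mix hR hy hc) hk
    have h₂ := hu _ m _ k hm hx hk
    have h₃ := hu _ m _ k hm hy hk
    refine mul_right_cancel₀ hpos.ne' ?_
    rw [h₁, hc, ← h₂, ← h₃]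
    ring
  · obtain ⟨m, lx, ly, k, hm, hx, hy, hk, hpos⟩ := common w w
    have h₁ := hu _ m _ k hm (IsCalibrated.zero hR w m) hk
    simpa [hpos.ne'] using h₁
  · obtain ⟨m, lx, ly, k, hm, hx, hy, hk, hpos⟩ := common x y
    rw [hx.rel_iff hR hm hy, ← Subtype.coe_le_coe, ← hu _ m _ k hm hx hk, ← hu _ m _ k hm hy hk,
      mul_le_mul_iff_left₀ hpos]

end IsMBA

/-- `V` is a utility function for the acts that extends the affine utility `u` for consequences,
whose least value is `0`. -/
structure IsUtilityExtension {S : Type*} {𝒜 : BooleanSubalgebra (Set S)}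
    {E : Type*} [AddCommGroup E] [Module ℝ E] {X : Set E} (hX : Convex ℝ X)
    (R : SimpleAct 𝒜 X → SimpleAct 𝒜 X → Prop) (u : X → ℝ) (V : SimpleAct 𝒜 X → ℝ) : Prop where
  affine : IsAffineUtility hX u
  min_eq_zero : IsLeast (Set.range u) 0
  represents : ∀ f g, R f g ↔ V g ≤ V f
  normalized : ∀ x : X, V (SimpleAct.const 𝒜 x) = u x
  monotone : ∀ f g : SimpleAct 𝒜 X, (∀ s, u (g s) ≤ u (f s)) → V g ≤ V f

/-! ### Certainty equivalents and the value of an act -/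

section Acts

variable {S : Type*} {𝒜 : BooleanSubalgebra (Set S)}
  {E : Type*} [AddCommGroup E] [Module ℝ E] {X : Set E} {hX : Convex ℝ X}
  {R : SimpleAct 𝒜 X → SimpleAct 𝒜 X → Prop} {u : X → ℝ} {V : SimpleAct 𝒜 X → ℝ}

theorem SimpleAct.exists_forall_le [Nonempty S] {C : Type*} (u : C → ℝ) (f : SimpleAct 𝒜 C) :
    ∃ s₀, ∀ s, u (f s) ≤ u (f s₀) := by
  obtain ⟨_, ⟨s₀, rfl⟩, h⟩ := Set.exists_max_image _ u f.finite_range (Set.range_nonempty f)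
  exact ⟨s₀, fun s => h _ ⟨s, rfl⟩⟩

/-- The positive values of a simple function are bounded away from `0`. -/
theorem SimpleAct.exists_pos_gap {C : Type*} (v : C → ℝ) (f : SimpleAct 𝒜 C) :
    ∃ η > 0, ∀ s, 0 < v (f s) → η ≤ v (f s) := by
  by_cases h : ∃ s, 0 < v (f s)
  · obtain ⟨s, hs⟩ := h
    have hfin : (Set.range f ∩ {c | 0 < v c}).Finite := f.finite_range.inter_of_left _
    obtain ⟨c, hc, hmin⟩ := Set.exists_min_image _ v hfin ⟨f s, ⟨s, rfl⟩, hs⟩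
    exact ⟨v c, hc.2, fun s hs => hmin _ ⟨⟨s, rfl⟩, hs⟩⟩
  · exact ⟨1, one_pos, fun s hs => (h ⟨s, hs⟩).elim⟩

theorem IsMBA.exists_utilityExtension [Nonempty S] (hR : IsMBA hX R) {w : X} (hw : IsWorst R w) :
    ∃ u V, IsUtilityExtension hX R u V := by
  obtain ⟨u, hu, hu0, hrep⟩ := hR.exists_affine_utility hw
  -- By monotonicity `f` lies between its best and worst values, so it is indifferent to one of them
  -- or to a mixture of them.
  have hce : ∀ f, ∃ x, Indiff R f (SimpleAct.const 𝒜 x) := by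
    intro f
    obtain ⟨s₁, h₁⟩ := f.exists_forall_le u
    obtain ⟨s₀, h₀⟩ := f.exists_forall_le (fun x => - u x)
    have h₁' : R (SimpleAct.const 𝒜 (f s₁)) f := hR.monotone _ _ fun s => (hrep _ _).2 (h₁ s)
    have h₀' : R f (SimpleAct.const 𝒜 (f s₀)) :=
      hR.monotone _ _ fun s => (hrep _ _).2 (neg_le_neg_iff.1 (h₀ s))
    by_cases h : R (SimpleAct.const 𝒜 (f s₀)) (SimpleAct.const 𝒜 (f s₁))
    · exact ⟨f s₀, h₀', hR.transitive _ _ _ h h₁'⟩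
    · obtain ⟨l, hl⟩ := hR.exists_indiff (hR.strictPref_iff.2 h) h₁' h₀'
      exact ⟨_, hl⟩
  choose ce hce using hce
  have hrep' : ∀ f g, R f g ↔ u (ce g) ≤ u (ce f) := by
    intro f g
    rw [← hrep]
    exact ⟨fun h => hR.transitive _ _ _ (hce f).2 (hR.transitive _ _ _ h (hce g).1),
      fun h => hR.transitive _ _ _ (hce f).1 (hR.transitive _ _ _ h (hce g).2)⟩
  refine ⟨u, fun f => u (ce f), hu, ⟨⟨w, hu0⟩, ?_⟩, hrep', fun x => ?_, fun f g h => ?_⟩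
  · rintro _ ⟨x, rfl⟩
    rw [← hu0]
    exact (hrep _ _).1 (hw x)
  · exact le_antisymm ((hrep _ _).1 (hce _).1) ((hrep _ _).1 (hce _).2)
  · rw [← hrep']
    exact hR.monotone _ _ fun s => (hrep _ _).2 (h s)

namespace IsUtilityExtension

theorem utility_nonneg (hV : IsUtilityExtension hX R u V) (x : X) : 0 ≤ u x :=
  hV.min_eq_zero.2 ⟨x, rfl⟩

theorem rel_const_iff (hV : IsUtilityExtension hX R u V) (x y : X) :
    R (SimpleAct.const 𝒜 x) (SimpleAct.const 𝒜 y) ↔ u y ≤ u x := by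
  rw [hV.represents, hV.normalized, hV.normalized]

theorem strictPref_iff (hV : IsUtilityExtension hX R u V) {f g} :
    StrictPref R f g ↔ V g < V f := by
  rw [StrictPref, hV.represents, hV.represents, not_le, and_iff_right_of_imp le_of_lt]

theorem isWorst_iff (hV : IsUtilityExtension hX R u V) (x : X) : IsWorst R x ↔ u x = 0 := by
  simp only [IsWorst, hV.rel_const_iff]
  obtain ⟨w, hw⟩ := hV.min_eq_zero.1
  exact ⟨fun h => le_antisymm (hw ▸ h w) (hV.utility_nonneg x),
    fun h y => h ▸ hV.utility_nonneg y⟩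

theorem exists_utility_eq (hV : IsUtilityExtension hX R u V) {x : X} {c : ℝ} (h0 : 0 ≤ c)
    (hc : c ≤ u x) : ∃ y, u y = c := by
  obtain ⟨w, hw⟩ := hV.min_eq_zero.1
  rcases h0.eq_or_lt with rfl | hpos
  · exact ⟨w, hw⟩
  have hx := hpos.trans_le hc
  refine ⟨mixPt hX ⟨c / u x, div_nonneg h0 hx.le, (div_le_one hx).2 hc⟩ x w, ?_⟩
  rw [hV.affine, hw]
  field_simp
  simp

theorem value_nonneg (hV : IsUtilityExtension hX R u V) (f : SimpleAct 𝒜 X) : 0 ≤ V f := by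
  obtain ⟨w, hw⟩ := hV.min_eq_zero.1
  rw [← hw, ← hV.normalized]
  exact hV.monotone _ _ fun s => hw.trans_le (hV.utility_nonneg _)

theorem exists_utility_eq_value [Nonempty S] (hV : IsUtilityExtension hX R u V)
    (f : SimpleAct 𝒜 X) : ∃ x, u x = V f := by
  obtain ⟨s₁, h₁⟩ := f.exists_forall_le u
  refine hV.exists_utility_eq (x := f s₁) (hV.value_nonneg f) ?_
  rw [← hV.normalized]
  exact hV.monotone _ _ h₁

end IsUtilityExtension

end Acts

/-! ### Scaling, continuity and the representation -/

section Representation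

variable {S : Type*} {𝒜 : BooleanSubalgebra (Set S)}
  {E : Type*} [AddCommGroup E] [Module ℝ E] {X : Set E} {hX : Convex ℝ X}
  {R : SimpleAct 𝒜 X → SimpleAct 𝒜 X → Prop} {u : X → ℝ} {V : SimpleAct 𝒜 X → ℝ}

namespace IsUtilityExtension

/-- Choose `y` so that its mixture with `w` of weight a has the value of the mixed act. Decreasing
aversion carries the comparison to larger weights b, and b → 1 gives u(y) ≤ V(f). -/
theorem value_mixAct_worst_le [Nonempty S] (hV : IsUtilityExtension hX R u V)
    (hD : IsDRAA hX R) {w : X} (hw : u w = 0) (f : SimpleAct 𝒜 X) {a : unitInterval}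
    (ha : 0 < a) : V (mixAct hX a f (SimpleAct.const 𝒜 w)) ≤ a * V f := by
  have ha' : (0 : ℝ) < a := ha
  have hle : ∀ b : unitInterval, V (mixAct hX b f (SimpleAct.const 𝒜 w)) ≤ V f := by
    refine fun b => hV.monotone _ _ fun s => ?_
    rw [mixAct_apply, hV.affine, SimpleAct.const_apply, hw, mul_zero, add_zero]
    exact mul_le_of_le_one_left (hV.utility_nonneg _) b.2.2
  obtain ⟨s₁, h₁⟩ := f.exists_forall_le u
  obtain ⟨y, hy⟩ : ∃ y, u y = V (mixAct hX a f (SimpleAct.const 𝒜 w)) / a := by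
    refine hV.exists_utility_eq (x := f s₁) (div_nonneg (hV.value_nonneg _) ha'.le) ?_
    rw [div_le_iff₀ ha']
    calc V (mixAct hX a f (SimpleAct.const 𝒜 w))
        ≤ V (SimpleAct.const 𝒜 (mixPt hX a (f s₁) w)) := by
          refine hV.monotone _ _ fun s => ?_
          rw [mixAct_apply, SimpleAct.const_apply, SimpleAct.const_apply, hV.affine, hV.affine]
          exact add_le_add_left (mul_le_mul_of_nonneg_left (h₁ s) ha'.le) _
      _ = u (f s₁) * a := by rw [hV.normalized, hV.affine, hw]; ring
  have hya : V (mixAct hX a f (SimpleAct.const 𝒜 w)) = a * u y := by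
    rw [hy]; field_simp
  rw [hya]
  refine mul_le_mul_of_nonneg_left ?_ ha'.le
  rcases eq_or_ne a 1 with rfl | h1
  · have := hle 1
    rw [hya] at this
    simpa using this
  have ha1 : (a : ℝ) < 1 := unitInterval.lt_one_iff_ne_one.2 h1
  refine le_of_forall_lt fun c hc => ?_
  -- The axiom only covers b < 1, so the mixed act is bounded by `f` through monotonicity and the
  -- limit is taken on the utility side alone.
  have hb : ∀ b : unitInterval, a ≤ b → b < 1 → b * u y ≤ V f := by
    intro b hab hb1
    have := hD w ((hV.isWorst_iff w).2 hw) f y a b ha hab hb1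
      ((hV.represents _ _).2 (by rw [hV.normalized, hV.affine, hw, hya]; simp))
    rw [hV.represents, hV.normalized, hV.affine, hw, mul_zero, add_zero] at this
    exact this.trans (hle b)
  rcases (hV.utility_nonneg y).eq_or_lt with h0 | hpos
  · rw [← h0] at hc
    exact hc.trans_le (hV.value_nonneg f)
  obtain ⟨t, ht, ht1⟩ : ∃ t : ℝ, max (a : ℝ) (c / u y) < t ∧ t < 1 :=
    exists_between (max_lt ha1 ((div_lt_one hpos).2 hc))
  have hat := (le_max_left _ _).trans_lt ht
  have hct := (le_max_right _ _).trans_lt ht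
  exact ((div_lt_iff₀ hpos).1 hct).trans_le
    (hb ⟨t, (ha'.trans hat).le, ht1.le⟩ (Subtype.coe_le_coe.1 hat.le) (Subtype.coe_lt_coe.1 ht1))

/-- Upper semicontinuity: acts near `f` are dominated by a constant `M` or by a mixture of `M` with
`f` whose value is below c. -/
theorem exists_forall_lt_add [Nonempty S] (hV : IsUtilityExtension hX R u V)
    (hR : IsMBA hX R) (f : SimpleAct 𝒜 X) {c : ℝ} (hc : V f < c) :
    ∃ δ > 0, ∀ g : SimpleAct 𝒜 X, (∀ s, |u (g s) - u (f s)| < δ) → V g ≤ c := by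
  -- A uniform gap below `M` can fail only if `f` reaches the maximum of `u`; at such states no
  -- perturbation can raise utility.
  obtain ⟨M, η, hη, hM⟩ : ∃ (M : X) (η : ℝ), 0 < η ∧
      ∀ s, u (f s) + η ≤ u M ∨ (u (f s) = u M ∧ ∀ x, u x ≤ u M) := by
    obtain ⟨s₁, h₁⟩ := f.exists_forall_le u
    by_cases h : ∃ M, u (f s₁) < u M
    · obtain ⟨M, hM⟩ := h
      exact ⟨M, u M - u (f s₁), sub_pos.2 hM, fun s => .inl (by linarith [h₁ s])⟩
    · have hmax : ∀ x, u x ≤ u (f s₁) := fun x => not_lt.1 fun hx => h ⟨x, hx⟩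
      obtain ⟨η, hη, hgap⟩ := f.exists_pos_gap fun x => u (f s₁) - u x
      refine ⟨f s₁, η, hη, fun s => ?_⟩
      rcases (h₁ s).eq_or_lt with he | hlt
      · exact .inr ⟨he, hmax⟩
      · exact .inl (by linarith [hgap s (sub_pos.2 hlt)])
  by_cases hMc : u M ≤ c
  · refine ⟨η, hη, fun g hg => le_trans ?_ hMc⟩
    rw [← hV.normalized]
    refine hV.monotone _ _ fun s => ?_
    rw [SimpleAct.const_apply]
    rcases hM s with h | h
    · linarith [(abs_lt.1 (hg s)).2]
    · exact h.2 _
  · rw [not_le] at hMc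
    obtain ⟨y, hy⟩ := hV.exists_utility_eq ((hV.value_nonneg f).trans hc.le) hMc.le
    obtain ⟨-, b, -, -, hb0, -, -, hb⟩ := hR.archimedean (SimpleAct.const 𝒜 M)
      (SimpleAct.const 𝒜 y) f (hV.strictPref_iff.2 (by simpa [hV.normalized, hy] using hMc))
      (hV.strictPref_iff.2 (by simpa [hV.normalized, hy] using hc))
    rw [hV.strictPref_iff, hV.normalized, hy] at hb
    have hb0' : (0 : ℝ) < b := hb0
    refine ⟨b * η, mul_pos hb0' hη, fun g hg => le_trans (hV.monotone _ _ fun s => ?_) hb.le⟩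
    rw [mixAct_apply, hV.affine, SimpleAct.const_apply]
    rcases hM s with h | h
    · have := (abs_lt.1 (hg s)).2
      nlinarith
    · rw [h.1]
      linarith [h.2 (g s)]

/-- Lower semicontinuity: acts near `f` dominate a slight dilution of `f` by `w`. States with u(f) =
0 are harmless because `u` is nonnegative, and the other values are at least some η > 0. -/
theorem exists_forall_sub_lt [Nonempty S] (hV : IsUtilityExtension hX R u V)
    (hR : IsMBA hX R) (f : SimpleAct 𝒜 X) {c : ℝ} (hc : c < V f) :
    ∃ δ > 0, ∀ g : SimpleAct 𝒜 X, (∀ s, |u (g s) - u (f s)| < δ) → c ≤ V g := by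
  rcases le_or_gt c 0 with hc0 | hc0
  · exact ⟨1, one_pos, fun g _ => hc0.trans (hV.value_nonneg g)⟩
  obtain ⟨w, hw⟩ := hV.min_eq_zero.1
  obtain ⟨x, hx⟩ := hV.exists_utility_eq_value f
  obtain ⟨y, hy⟩ := hV.exists_utility_eq hc0.le (hc.le.trans_eq hx.symm)
  obtain ⟨a, -, -, ha1, -, -, ha, -⟩ := hR.archimedean f (SimpleAct.const 𝒜 y)
    (SimpleAct.const 𝒜 w) (hV.strictPref_iff.2 (by simpa [hV.normalized, hy] using hc))
    (hV.strictPref_iff.2 (by simpa [hV.normalized, hy, hw] using hc0))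
  rw [hV.strictPref_iff, hV.normalized, hy] at ha
  have ha1' : (a : ℝ) < 1 := ha1
  obtain ⟨η, hη, hgap⟩ := f.exists_pos_gap u
  refine ⟨(1 - a) * η, mul_pos (sub_pos.2 ha1') hη,
    fun g hg => le_trans ha.le (hV.monotone _ _ fun s => ?_)⟩
  rw [mixAct_apply, hV.affine, SimpleAct.const_apply, hw, mul_zero, add_zero]
  rcases (hV.utility_nonneg (f s)).eq_or_lt with h | h
  · rw [← h, mul_zero]
    exact hV.utility_nonneg _
  · have h₁ := (abs_lt.1 (hg s)).1
    have h₂ := hgap s h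
    nlinarith

theorem continuous_value [Nonempty S] (hV : IsUtilityExtension hX R u V)
    (hR : IsMBA hX R) (f : SimpleAct 𝒜 X) (ε : ℝ) (hε : 0 < ε) :
    ∃ δ > 0, ∀ g : SimpleAct 𝒜 X, (∀ s, |u (g s) - u (f s)| < δ) → |V g - V f| < ε := by
  obtain ⟨δ₁, hδ₁, h₁⟩ := hV.exists_forall_lt_add hR f (c := V f + ε / 2) (by linarith)
  obtain ⟨δ₂, hδ₂, h₂⟩ := hV.exists_forall_sub_lt hR f (c := V f - ε / 2) (by linarith)
  refine ⟨min δ₁ δ₂, lt_min hδ₁ hδ₂, fun g hg => ?_⟩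
  have k₁ := h₁ g fun s => (hg s).trans_le (min_le_left _ _)
  have k₂ := h₂ g fun s => (hg s).trans_le (min_le_right _ _)
  rw [abs_lt]
  constructor <;> linarith

theorem isMaxMinConf_value [Nonempty S] (hV : IsUtilityExtension hX R u V)
    (hD : IsDRAA hX R) (f : SimpleAct 𝒜 X) :
    IsMaxMinConf (SimpleAct.map u f)
      {d | ∃ g : SimpleAct 𝒜 X, (∀ s, u (g s) ≤ u (f s)) ∧ d = confFun (SimpleAct.map u g) (V g)}
      (V f).toNNReal := by
  obtain ⟨w, hw⟩ := hV.min_eq_zero.1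
  have main : ∀ g : SimpleAct 𝒜 X, (∀ s, u (g s) ≤ u (f s)) → 0 < V g → ∃ t : ℝ,
      0 ≤ t ∧ (∀ s, t * u (g s) ≤ u (f s)) ∧ (∃ s, 0 < u (g s) ∧ u (f s) = t * u (g s)) ∧
      IsLeast (Set.range (confRatio (SimpleAct.map u f) (confFun (SimpleAct.map u g) (V g))))
        (ENNReal.ofReal (t * V g)) := by
    intro g _ hg
    refine exists_isLeast_confRatio_confFun (φ := SimpleAct.map u f) (ψ := SimpleAct.map u g)
      (fun s => hV.utility_nonneg _) hg ?_ fun s => hV.utility_nonneg _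
    by_contra hne
    refine hg.not_ge ?_
    rw [← hw, ← hV.normalized]
    refine hV.monotone _ _ fun s => ?_
    rw [SimpleAct.const_apply, hw]
    exact not_lt.1 fun h => hne ⟨s, h⟩
  have bound : ∀ (g : SimpleAct 𝒜 X) (t : ℝ), 1 ≤ t → (∀ s, t * u (g s) ≤ u (f s)) →
      t * V g ≤ V f := by
    intro g t ht h
    have ht0 : 0 < t := one_pos.trans_le ht
    -- Diluting `f` by `w` with weight 1 / t still dominates `g`.
    let a : unitInterval := ⟨t⁻¹, inv_nonneg.2 ht0.le, inv_le_one_of_one_le₀ ht⟩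
    have h₁ : V g ≤ V (mixAct hX a f (SimpleAct.const 𝒜 w)) := by
      refine hV.monotone _ _ fun s => ?_
      rw [mixAct_apply, hV.affine, SimpleAct.const_apply, hw, mul_zero, add_zero]
      exact (le_inv_mul_iff₀ ht0).2 (h s)
    have h₂ := hV.value_mixAct_worst_le hD hw f (a := a) (Subtype.coe_lt_coe.1 (inv_pos.2 ht0))
    exact (le_inv_mul_iff₀ ht0).1 (h₁.trans h₂)
  refine ⟨?_, ⟨⟨_, ⟨f, fun s => le_rfl, rfl⟩, ?_⟩, ?_⟩⟩
  · rintro d ⟨g, hg, rfl⟩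
    rcases (hV.value_nonneg g).eq_or_lt with h0 | hpos
    · rw [← h0]
      exact ⟨0, isLeast_confRatio_confFun_zero _ _⟩
    · obtain ⟨t, -, -, -, h⟩ := main g hg hpos
      exact ⟨_, h⟩
  · rcases (hV.value_nonneg f).eq_or_lt with h0 | hpos
    · rw [← h0]
      simpa using isLeast_confRatio_confFun_zero (SimpleAct.map u f) (SimpleAct.map u f)
    · obtain ⟨t, -, -, ⟨s, hs, hst⟩, h⟩ := main f (fun s => le_rfl) hpos
      have ht : t = 1 := mul_right_cancel₀ hs.ne' (by rw [one_mul, ← hst])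
      rw [ht, one_mul] at h
      exact h
  · rintro m ⟨d, ⟨g, hg, rfl⟩, hm⟩
    rcases (hV.value_nonneg g).eq_or_lt with h0 | hpos
    · rw [← h0] at hm
      rw [hm.unique (isLeast_confRatio_confFun_zero _ _)]
      exact bot_le
    · obtain ⟨t, ht0, htle, ⟨s, hs, hst⟩, h⟩ := main g hg hpos
      rw [hm.unique h]
      -- That t ≥ 1 follows at a state where t u(g) = u(f) and u(g) > 0, since u(g) ≤ u(f).
      refine ENNReal.ofReal_le_ofReal (bound g t ?_ htle)
      refine le_of_mul_le_mul_right ?_ hs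
      rw [one_mul, ← hst]
      exact hg s

end IsUtilityExtension

theorem IsMBA.exists_confidenceRep [Nonempty S] (hR : IsMBA hX R) (hw : ∃ w : X, IsWorst R w)
    (hD : IsDRAA hX R) : ∃ (u : X → ℝ) (D : SimpleAct 𝒜 X → Set (finAddProb 𝒜 → ℝ≥0∞))
      (V : SimpleAct 𝒜 X → ℝ≥0), IsConfidenceRep hX R u D V := by
  obtain ⟨w, hw⟩ := hw
  obtain ⟨u, V, hV⟩ := hR.exists_utilityExtension hw
  have hcoe : ∀ f, ((V f).toNNReal : ℝ) = V f := fun f => Real.coe_toNNReal _ (hV.value_nonneg f)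
  refine ⟨u, _, fun f => (V f).toNNReal, hV.affine, hV.min_eq_zero, ?_, ?_,
    hV.isMaxMinConf_value hD, ?_, ?_, ?_, ?_⟩
  · rintro f d ⟨g, -, rfl⟩
    exact upperSemicontinuous_confFun _ _
  · rintro f d ⟨g, -, rfl⟩
    exact isQuasiconcave_confFun _ (hV.value_nonneg g)
  · intro f g
    rw [hV.represents, ← NNReal.coe_le_coe, hcoe, hcoe]
  · intro x
    rw [hcoe, hV.normalized]
  · rintro f g hfg d ⟨h, hh, rfl⟩
    exact ⟨h, fun s => (hh s).trans (hfg s), rfl⟩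
  · intro f ε hε
    simpa only [hcoe] using hV.continuous_value hR f ε hε

/-! ### From the representation back to the axioms -/

theorem mul_confRatio_le {φ φ' : SimpleAct 𝒜 ℝ} {t : ℝ} (ht : 0 ≤ t)
    (h : ∀ s, t * φ s ≤ φ' s) (d : finAddProb 𝒜 → ℝ≥0∞) (p : finAddProb 𝒜) :
    ENNReal.ofReal t * confRatio φ d p ≤ confRatio φ' d p := by
  unfold confRatio
  split_ifs
  · exact le_top
  · rw [← mul_div_assoc, ← ENNReal.ofReal_mul ht]
    exact ENNReal.div_le_div_right (ENNReal.ofReal_le_ofReal (mul_simpleIntegral_le h p)) _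

/-- A function d optimal for φ is also available for φ'. At the p minimising its ratio for φ', that
ratio is at most v' and at least t times the ratio for φ, itself at least v. -/
theorem IsMaxMinConf.mul_le {φ φ' : SimpleAct 𝒜 ℝ} {D D' : Set (finAddProb 𝒜 → ℝ≥0∞)}
    {v v' : ℝ≥0} (hv : IsMaxMinConf φ D v) (hv' : IsMaxMinConf φ' D' v') (hD : D ⊆ D')
    {t : ℝ} (ht : 0 ≤ t) (h : ∀ s, t * φ s ≤ φ' s) : t * v ≤ v' := by
  obtain ⟨d, hd, hmin⟩ := hv.2.1
  obtain ⟨m, hm⟩ := hv'.1 d (hD hd)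
  have h₁ : m ≤ v' := hv'.2.2 ⟨d, hD hd, hm⟩
  obtain ⟨p, rfl⟩ := hm.1
  have h₂ : ENNReal.ofReal t * v ≤ v' :=
    (mul_le_mul_right (hmin.2 ⟨p, rfl⟩) _).trans ((mul_confRatio_le ht h d p).trans h₁)
  rw [ENNReal.ofReal, ← ENNReal.coe_mul, ENNReal.coe_le_coe, ← NNReal.coe_le_coe,
    NNReal.coe_mul, Real.coe_toNNReal _ ht] at h₂
  exact h₂

/-- Mixtures with a small weight are uniformly close in utility. -/
theorem SimpleAct.exists_weight_lt {C : Type*} (u : C → ℝ) (f g : SimpleAct 𝒜 C) {δ : ℝ}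
    (hδ : 0 < δ) : ∃ e : unitInterval, 0 < e ∧ e < 1 ∧ ∀ s, e * |u (f s) - u (g s)| < δ := by
  obtain ⟨B, hB⟩ := (SimpleAct.map₂ (fun x y => |u x - u y|) f g).finite_range.bddAbove
  have hB' : ∀ s, |u (f s) - u (g s)| ≤ B := fun s => hB ⟨s, rfl⟩
  have hpos : 0 < |B| + 1 := by positivity
  have hm : 0 < min (1 / 2) (δ / (|B| + 1)) := lt_min (by norm_num) (div_pos hδ hpos)
  have hm1 : min (1 / 2) (δ / (|B| + 1)) < 1 := (min_le_left _ _).trans_lt (by norm_num)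
  refine ⟨⟨_, hm.le, hm1.le⟩, Subtype.coe_lt_coe.1 hm, Subtype.coe_lt_coe.1 hm1, fun s => ?_⟩
  calc min (1 / 2) (δ / (|B| + 1)) * |u (f s) - u (g s)|
      < min (1 / 2) (δ / (|B| + 1)) * (|B| + 1) :=
        mul_lt_mul_of_pos_left (by linarith [hB' s, le_abs_self B]) hm
    _ ≤ δ / (|B| + 1) * (|B| + 1) := mul_le_mul_of_nonneg_right (min_le_right _ _) hpos.le
    _ = δ := div_mul_cancel₀ _ hpos.ne'

theorem IsUtilityExtension.isMBA (hV : IsUtilityExtension hX R u V)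
    (hcont : ∀ f : SimpleAct 𝒜 X, ∀ ε > 0, ∃ δ > 0, ∀ g : SimpleAct 𝒜 X,
      (∀ s, |u (g s) - u (f s)| < δ) → |V g - V f| < ε) : IsMBA hX R where
  complete f g := by
    rw [hV.represents, hV.represents]
    exact le_total _ _
  transitive f g h := by
    rw [hV.represents, hV.represents, hV.represents]
    exact fun h₁ h₂ => h₂.trans h₁
  risk_independence_indiff x y z a _ _ := by
    simp only [Indiff, hV.rel_const_iff, hV.affine a]
    rintro ⟨h₁, h₂⟩
    rw [le_antisymm h₁ h₂]
    exact ⟨le_rfl, le_rfl⟩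
  risk_independence_strict x y z a ha _ := by
    simp only [hV.strictPref_iff, hV.normalized, hV.affine a]
    exact fun h => add_lt_add_left (mul_lt_mul_of_pos_left h ha) _
  archimedean f g h hfg hgh := by
    rw [hV.strictPref_iff] at hfg hgh
    obtain ⟨δ₁, hδ₁, k₁⟩ := hcont f (V f - V g) (sub_pos.2 hfg)
    obtain ⟨δ₂, hδ₂, k₂⟩ := hcont h (V g - V h) (sub_pos.2 hgh)
    obtain ⟨a, ha0, ha1, ha⟩ := SimpleAct.exists_weight_lt u h f hδ₁
    obtain ⟨b, hb0, hb1, hb⟩ := SimpleAct.exists_weight_lt u f h hδ₂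
    -- Here `a` is the small weight put on `h`, so `f` receives 1 - a.
    refine ⟨unitInterval.symm a, b, ?_, ?_, hb0, hb1, ?_, ?_⟩
    · exact Subtype.coe_lt_coe.1 (sub_pos.2 (Subtype.coe_lt_coe.2 ha1))
    · exact Subtype.coe_lt_coe.1 (sub_lt_self _ (Subtype.coe_lt_coe.2 ha0))
    · rw [hV.strictPref_iff]
      have := k₁ (mixAct hX (unitInterval.symm a) f h) fun s => by
        convert ha s using 1
        rw [mixAct_apply, hV.affine, unitInterval.coe_symm_eq, ← abs_of_nonneg a.2.1, ← abs_mul,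
          abs_of_nonneg a.2.1]
        congr 1
        ring
      linarith [(abs_lt.1 this).1]
    · rw [hV.strictPref_iff]
      have := k₂ (mixAct hX b f h) fun s => by
        convert hb s using 1
        rw [mixAct_apply, hV.affine, ← abs_of_nonneg b.2.1, ← abs_mul, abs_of_nonneg b.2.1]
        congr 1
        ring
      linarith [(abs_lt.1 this).2]
  monotone f g h :=
    (hV.represents _ _).2 (hV.monotone _ _ fun s => (hV.rel_const_iff _ _).1 (h s))

namespace IsConfidenceRep

variable {D : SimpleAct 𝒜 X → Set (finAddProb 𝒜 → ℝ≥0∞)} {W : SimpleAct 𝒜 X → ℝ≥0}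

theorem isUtilityExtension (h : IsConfidenceRep hX R u D W) :
    IsUtilityExtension hX R u fun f => (W f : ℝ) where
  affine := h.affine
  min_eq_zero := h.min_eq_zero
  represents := h.represents
  normalized := h.normalized
  monotone f g hfg := by
    have := (h.value g).mul_le (h.value f) (h.increasing g f hfg) zero_le_one
      fun s => (one_mul _).trans_le (hfg s)
    rwa [one_mul] at this

theorem isDRAA (h : IsConfidenceRep hX R u D W) : IsDRAA hX R := by
  intro w hw f y a b ha hab hb hR
  have hV := h.isUtilityExtension
  rw [hV.isWorst_iff] at hw
  have ha' : (0 : ℝ) < a := ha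
  have hab' : (a : ℝ) ≤ b := hab
  have key := (h.value (mixAct hX a f (SimpleAct.const 𝒜 w))).mul_le
    (h.value (mixAct hX b f (SimpleAct.const 𝒜 w))) (h.increasing _ _ fun s => by
      rw [mixAct_apply, mixAct_apply, h.affine, h.affine, SimpleAct.const_apply, hw, mul_zero,
        mul_zero, add_zero, add_zero]
      exact mul_le_mul_of_nonneg_right hab' (hV.utility_nonneg _))
    -- Since u(w) = 0, the two mixed profiles are a u(f) and b u(f), proportional with factor b / a.
    (t := b / a) (div_nonneg b.2.1 ha'.le) fun s => by
      change b / a * u (mixPt hX a (f s) w) ≤ u (mixPt hX b (f s) w)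
      rw [h.affine, h.affine, hw, mul_zero, mul_zero, add_zero, add_zero]
      refine le_of_eq ?_
      field_simp
  rw [hV.represents, hV.normalized, h.affine, hw, mul_zero, add_zero] at hR ⊢
  refine le_trans ?_ key
  calc (b : ℝ) * u y = b / a * (a * u y) := by field_simp
    _ ≤ _ := mul_le_mul_of_nonneg_left hR (div_nonneg b.2.1 ha'.le)

end IsConfidenceRep

end Representation

theorem proposition2 {S : Type*} [Nonempty S] (𝒜 : BooleanSubalgebra (Set S))
    {E : Type*} [AddCommGroup E] [Module ℝ E] (X : Set E) (hXne : X.Nonempty)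
    (hX : Convex ℝ X) (R : SimpleAct 𝒜 X → SimpleAct 𝒜 X → Prop) :
    (IsMBA hX R ∧ (∃ w : X, IsWorst R w) ∧ IsDRAA hX R) ↔
      ∃ (u : X → ℝ) (D : SimpleAct 𝒜 X → Set (finAddProb 𝒜 → ℝ≥0∞))
        (V : SimpleAct 𝒜 X → ℝ≥0), IsConfidenceRep hX R u D V := by
  constructor
  · rintro ⟨hR, hw, hD⟩
    exact hR.exists_confidenceRep hw hD
  · rintro ⟨u, D, V, h⟩
    have hV := h.isUtilityExtension
    obtain ⟨w, hw⟩ := hV.min_eq_zero.1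
    exact ⟨hV.isMBA h.continuous, ⟨w, (hV.isWorst_iff w).2 hw⟩, h.isDRAA⟩
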